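/- Let $m\ge 0$ be an integer, let $\|\cdot\|$ be the Euclidean norm on $\mathbb{R}^m$, let $Y$ be an arbitrary set, and let $v\colon Y\to\mathbb{R}^m$ be an arbitrary map. Let $A\subset Y$ and let $u\colon A\to\mathbb{R}^m$ satisfy $$\|u(x)-u(y)\|\le\|v(x)-v(y)\|\qquad\text{for all }x,y\in A.$$ Then there exists a map $\tilde u\colon Y\to\mathbb{R}^m$ with $\tilde u(x)=u(x)$ for all $x\in A$ such that $$\|\tilde u(x)-\tilde u(y)\|\le\|v(x)-v(y)\|\qquad\text{for all }x,y\in Y,$$ and such that, for every real number $\delta\ge 0$, if $\|v(x)-u(x)\|\le\delta$ for all $x\in A$, then $\|v(x)-\tilde u(x)\|\le\delta$ for all $x\in Y$. -/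

import Mathlib

/-!
For points `a i`, `b i` with `dist (b i) (b j) ≤ dist (a i) (a j)` and any nonnegative weights `w`
of sum one, the weighted variance of `b` is at most that of `a`. Hence if `q` is placed relative to
the barycenter of `b` as `p` is relative to the barycenter of `a`, the weighted mean of
`dist q (b i) ^ 2` is at most that of `dist p (a i) ^ 2`, and `p - q` is the barycenter of the
displacements `a i - b i`. The minimax theorem replaces this choice of `q`, which depends on `w`, by
a single `q` with `dist q (b i) ≤ dist p (a i)` for all `i` and `p - q` in the convex hull of the
displacements. Weak compactness and Zorn's lemma turn this into an extension theorem in which every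
displacement stays in a prescribed closed convex set; the closed balls of radius `δ` around `0` are
handled simultaneously by taking their intersection.
-/

open Set Metric

section Minimax

theorem convexOn_finset_sum {𝕜 F β κ : Type*} [Semiring 𝕜] [PartialOrder 𝕜] [AddCommMonoid F]
    [SMul 𝕜 F] [AddCommMonoid β] [PartialOrder β] [IsOrderedAddMonoid β] [DistribSMul 𝕜 β]
    {K : Set F} {t : Finset κ} {g : κ → F → β} (hK : Convex 𝕜 K)
    (hg : ∀ i ∈ t, ConvexOn 𝕜 K (g i)) : ConvexOn 𝕜 K fun x => ∑ i ∈ t, g i x := by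
  refine ⟨hK, fun x hx y hy a b ha hb hab => ?_⟩
  simp only [Finset.smul_sum, ← Finset.sum_add_distrib]
  exact Finset.sum_le_sum fun i hi => (hg i hi).2 hx hy ha hb hab

variable {E ι : Type*} [TopologicalSpace E] [AddCommGroup E] [Module ℝ E]
  [IsTopologicalAddGroup E] [ContinuousSMul ℝ E] [Fintype ι]

theorem exists_forall_nonpos_of_forall_stdSimplex {K : Set E} (hK : IsCompact K)
    (hKne : K.Nonempty) {g : ι → E → ℝ} (hg_lsc : ∀ i, LowerSemicontinuousOn (g i) K)
    (hg : ∀ i, ConvexOn ℝ K (g i))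
    (h : ∀ w ∈ stdSimplex ℝ ι, ∃ x ∈ K, ∑ i, w i * g i x ≤ 0) :
    ∃ x ∈ K, ∀ i, g i x ≤ 0 := by
  classical
  rcases isEmpty_or_nonempty ι with _ | ⟨⟨i₀⟩⟩
  · exact hKne.imp fun x hx => ⟨hx, isEmptyElim⟩
  let f : E → (ι → ℝ) → ℝ := fun x w => ∑ i, w i * g i x
  have f_lsc : ∀ w ∈ stdSimplex ℝ ι, LowerSemicontinuousOn (fun x => f x w) K := fun w hw =>
    lowerSemicontinuousOn_sum fun i _ =>
      (continuous_const_mul (w i)).comp_lowerSemicontinuousOn (hg_lsc i)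
        (monotone_mul_left_of_nonneg (hw.1 i))
  have f_convex : ∀ w ∈ stdSimplex ℝ ι, ConvexOn ℝ K fun x => f x w := fun w hw =>
    convexOn_finset_sum (hg i₀).1 fun i _ => (hg i).smul (hw.1 i)
  have f_linear : ∀ x, IsLinearMap ℝ (f x) := fun x =>
    ⟨by simp [f, add_mul, Finset.sum_add_distrib], by simp [f, mul_assoc, Finset.mul_sum]⟩
  obtain ⟨x, hx, w, hw, hxw⟩ := Sion.exists_isSaddlePointOn' hKne hK f_lsc
    (fun w hw => (f_convex w hw).quasiconvexOn) (convex_stdSimplex ℝ ι) (isCompact_stdSimplex ℝ ι)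
    (fun x _ => (show Continuous (f x) by fun_prop).upperSemicontinuous.upperSemicontinuousOn _)
    (fun x _ => ((f_linear x).mk'.concaveOn (convex_stdSimplex ℝ ι)).quasiconcaveOn)
    (hg i₀).1 ⟨_, single_mem_stdSimplex ℝ i₀⟩
  obtain ⟨y, hy, hyw⟩ := h w hw
  refine ⟨x, hx, fun i => ?_⟩
  calc g i x = f x (Pi.single i 1) := by simp [f, Pi.single_apply]
    _ ≤ f y w := hxw y hy _ (single_mem_stdSimplex ℝ i)
    _ ≤ 0 := hyw

end Minimax

section WeakCompactness

open NormedSpace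

theorem surjective_inclusionInDoubleDual {𝕜 E : Type*} [RCLike 𝕜] [NormedAddCommGroup E]
    [InnerProductSpace 𝕜 E] [CompleteSpace E] :
    Function.Surjective (inclusionInDoubleDual 𝕜 E) := by
  intro φ
  let ψ : StrongDual 𝕜 E :=
    (starL 𝕜 : 𝕜 ≃L⋆[𝕜] 𝕜).toContinuousLinearMap.comp
      (φ.comp (InnerProductSpace.toDual 𝕜 E).toContinuousLinearEquiv.toContinuousLinearMap)
  refine ⟨(InnerProductSpace.toDual 𝕜 E).symm ψ, ContinuousLinearMap.ext fun f => ?_⟩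
  obtain ⟨x, rfl⟩ := (InnerProductSpace.toDual 𝕜 E).surjective f
  rw [dual_def, InnerProductSpace.toDual_apply_apply, ← inner_conj_symm,
    InnerProductSpace.toDual_symm_apply]
  simp [ψ]

theorem isCompact_toWeakSpace_image {E : Type*} [NormedAddCommGroup E] [NormedSpace ℝ E]
    (hE : Function.Surjective (inclusionInDoubleDual ℝ E)) {s : Set E} (hs : Convex ℝ s)
    (hs_closed : IsClosed s) (hs_bdd : Bornology.IsBounded s) :
    IsCompact (toWeakSpace ℝ E '' s) := by
  have hweak : Function.Surjective (inclusionInDoubleDualWeak ℝ E) := fun φ => hE φ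
  have hclosed : closure (toWeakSpace ℝ E '' s) = toWeakSpace ℝ E '' s := by
    rw [← hs.toWeakSpace_closure ℝ, hs_closed.closure_eq]
  rw [← hclosed]
  refine isCompact_closure_of_isBounded ℝ E _ ?_ (by simp [hweak.range_eq])
  rwa [preimage_image_eq _ (toWeakSpace ℝ E).injective]

theorem nonempty_iInter_of_convex_of_isClosed {E ι : Type*} [NormedAddCommGroup E]
    [NormedSpace ℝ E] (hE : Function.Surjective (inclusionInDoubleDual ℝ E)) {C : ι → Set E}
    (hconv : ∀ i, Convex ℝ (C i)) (hclosed : ∀ i, IsClosed (C i)) {i₀ : ι}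
    (hbdd : Bornology.IsBounded (C i₀))
    (hfin : ∀ F : Finset ι, F.Nonempty → (⋂ i ∈ F, C i).Nonempty) :
    (⋂ i, C i).Nonempty := by
  classical
  let D : ι → Set (WeakSpace ℝ E) := fun i => toWeakSpace ℝ E '' C i
  have hcompact : IsCompact (D i₀) :=
    isCompact_toWeakSpace_image hE (hconv i₀) (hclosed i₀) hbdd
  have hDclosed : ∀ i, IsClosed (D i) := fun i =>
    isClosed_of_closure_subset (by
      rw [← (hconv i).toWeakSpace_closure ℝ, (hclosed i).closure_eq])
  obtain ⟨_, ⟨x, -, rfl⟩, hx⟩ := hcompact.inter_iInter_nonempty D hDclosed fun F => by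
    obtain ⟨x, hx⟩ := hfin (insert i₀ F) (Finset.insert_nonempty _ _)
    simp only [Finset.set_biInter_insert] at hx
    exact ⟨toWeakSpace ℝ E x, mem_image_of_mem _ hx.1,
      mem_iInter₂.2 fun i hi => mem_image_of_mem _ (mem_iInter₂.1 hx.2 i hi)⟩
  exact ⟨x, mem_iInter.2 fun i =>
    (toWeakSpace ℝ E).injective.mem_set_image.1 (mem_iInter.1 hx i)⟩

end WeakCompactness

section Barycenter

variable {E ι : Type*} [NormedAddCommGroup E] [InnerProductSpace ℝ E] [Fintype ι] {w : ι → ℝ}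

theorem sum_mul_norm_sub_sq_eq_add (hw : ∑ i, w i = 1) (c : ι → E) (x : E) :
    ∑ i, w i * ‖x - c i‖ ^ 2 =
      ‖x - ∑ i, w i • c i‖ ^ 2 + ∑ i, w i * ‖∑ j, w j • c j - c i‖ ^ 2 := by
  have hcenter : ∑ i, w i * inner ℝ (x - ∑ j, w j • c j) (∑ j, w j • c j - c i) = 0 := by
    simp only [← inner_smul_right, ← inner_sum, smul_sub, Finset.sum_sub_distrib,
      ← Finset.sum_smul, hw, one_smul, sub_self, inner_zero_right]
  have hexpand : ∀ i, w i * ‖x - c i‖ ^ 2 = w i * ‖x - ∑ j, w j • c j‖ ^ 2 +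
      2 * (w i * inner ℝ (x - ∑ j, w j • c j) (∑ j, w j • c j - c i)) +
      w i * ‖∑ j, w j • c j - c i‖ ^ 2 := fun i => by
    rw [← sub_add_sub_cancel x (∑ j, w j • c j) (c i), norm_add_sq_real]
    ring
  simp only [hexpand, Finset.sum_add_distrib, ← Finset.mul_sum, ← Finset.sum_mul, hw, hcenter]
  ring

theorem sum_sum_mul_norm_sub_sq (hw : ∑ i, w i = 1) (c : ι → E) :
    ∑ i, w i * ∑ j, w j * ‖c i - c j‖ ^ 2 = 2 * ∑ i, w i * ‖∑ j, w j • c j - c i‖ ^ 2 := by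
  have hrow : ∀ i, ∑ j, w j * ‖c i - c j‖ ^ 2 =
      ‖∑ j, w j • c j - c i‖ ^ 2 + ∑ j, w j * ‖∑ k, w k • c k - c j‖ ^ 2 := fun i => by
    rw [sum_mul_norm_sub_sq_eq_add hw, norm_sub_rev]
  simp only [hrow, mul_add, Finset.sum_add_distrib, ← Finset.sum_mul, hw, one_mul, two_mul]

theorem sum_mul_norm_barycenter_sub_sq_le (hw : w ∈ stdSimplex ℝ ι) {a b : ι → E}
    (hab : ∀ i j, ‖b i - b j‖ ≤ ‖a i - a j‖) :
    ∑ i, w i * ‖∑ j, w j • b j - b i‖ ^ 2 ≤ ∑ i, w i * ‖∑ j, w j • a j - a i‖ ^ 2 := by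
  have hpairs : ∑ i, w i * ∑ j, w j * ‖b i - b j‖ ^ 2 ≤ ∑ i, w i * ∑ j, w j * ‖a i - a j‖ ^ 2 := by
    gcongr with i _ j _
    · exact hw.1 i
    · exact hw.1 j
    · exact hab i j
  rw [sum_sum_mul_norm_sub_sq hw.2, sum_sum_mul_norm_sub_sq hw.2] at hpairs
  exact le_of_mul_le_mul_left hpairs two_pos

theorem sum_mul_norm_sub_sq_le (hw : w ∈ stdSimplex ℝ ι) {a b : ι → E}
    (hab : ∀ i j, ‖b i - b j‖ ≤ ‖a i - a j‖) {p q : E} (hpq : p - q = ∑ i, w i • (a i - b i)) :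
    ∑ i, w i * ‖q - b i‖ ^ 2 ≤ ∑ i, w i * ‖p - a i‖ ^ 2 := by
  have hcenter : q - ∑ i, w i • b i = p - ∑ i, w i • a i := by
    simp only [smul_sub, Finset.sum_sub_distrib] at hpq
    rw [sub_eq_sub_iff_sub_eq_sub, ← neg_sub p q, hpq, neg_sub]
  rw [sum_mul_norm_sub_sq_eq_add hw.2 b q, sum_mul_norm_sub_sq_eq_add hw.2 a p, hcenter]
  exact add_le_add le_rfl (sum_mul_norm_barycenter_sub_sq_le hw hab)

end Barycenter

section OnePoint

variable {E ι : Type*} [NormedAddCommGroup E] [InnerProductSpace ℝ E] {a b : ι → E}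

theorem exists_dist_le_and_sub_mem_convexHull [Finite ι] [Nonempty ι]
    (hab : ∀ i j, dist (b i) (b j) ≤ dist (a i) (a j)) (p : E) :
    ∃ q, (∀ i, dist q (b i) ≤ dist p (a i)) ∧ p - q ∈ convexHull ℝ (range fun i => a i - b i) := by
  have := Fintype.ofFinite ι
  set K := convexHull ℝ (range fun i => a i - b i)
  have hK : Convex ℝ K := convex_convexHull ℝ _
  let g : ι → E → ℝ := fun i z => dist z (p - b i) ^ 2 - dist p (a i) ^ 2
  have g_convex : ∀ i, ConvexOn ℝ K (g i) := fun i =>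
    ((convexOn_dist (p - b i) hK).pow (fun _ _ => dist_nonneg) 2).sub (concaveOn_const _ hK)
  have g_lsc : ∀ i, LowerSemicontinuousOn (g i) K := fun i =>
    (show Continuous (g i) by fun_prop).lowerSemicontinuous.lowerSemicontinuousOn K
  have dist_sub : ∀ i z, dist z (p - b i) = dist (p - z) (b i) := fun i z => by
    rw [dist_eq_norm, dist_eq_norm, norm_sub_rev, sub_right_comm]
  have g_sum_nonpos : ∀ w ∈ stdSimplex ℝ ι, ∃ z ∈ K, ∑ i, w i * g i z ≤ 0 := fun w hw => by
    refine ⟨∑ i, w i • (a i - b i), hK.sum_mem (fun i _ => hw.1 i) hw.2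
      fun i _ => subset_convexHull ℝ _ (mem_range_self i), ?_⟩
    simp only [g, dist_sub, mul_sub, Finset.sum_sub_distrib, sub_nonpos]
    simp only [dist_eq_norm] at hab ⊢
    exact sum_mul_norm_sub_sq_le hw hab (sub_sub_cancel _ _)
  obtain ⟨z, hz, hgz⟩ := exists_forall_nonpos_of_forall_stdSimplex
    ((finite_range _).isCompact_convexHull ℝ) (range_nonempty _).convexHull g_lsc g_convex
    g_sum_nonpos
  refine ⟨p - z, fun i => ?_, by rwa [sub_sub_cancel]⟩
  rw [← dist_sub]
  exact le_of_sq_le_sq (sub_nonpos.1 (hgz i)) dist_nonneg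

theorem exists_dist_le_and_sub_mem [CompleteSpace E] {K : Set E} (hK : Convex ℝ K)
    (hK_closed : IsClosed K) (hK_ne : K.Nonempty)
    (hab : ∀ i j, dist (b i) (b j) ≤ dist (a i) (a j)) (habK : ∀ i, a i - b i ∈ K) (p : E) :
    ∃ q, (∀ i, dist q (b i) ≤ dist p (a i)) ∧ p - q ∈ K := by
  rcases isEmpty_or_nonempty ι with _ | ⟨⟨i₀⟩⟩
  · obtain ⟨k, hk⟩ := hK_ne
    exact ⟨p - k, isEmptyElim, by simpa using hk⟩
  let C : ι → Set E := fun i => closedBall (b i) (dist p (a i)) ∩ (fun q => p - q) ⁻¹' K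
  have C_convex : ∀ i, Convex ℝ (C i) := fun i =>
    (convex_closedBall _ _).inter
      (hK.affine_preimage (AffineMap.const ℝ E p - AffineMap.id ℝ E))
  have C_closed : ∀ i, IsClosed (C i) := fun i =>
    isClosed_closedBall.inter (hK_closed.preimage (by fun_prop))
  have C_finite_inter : ∀ F : Finset ι, F.Nonempty → (⋂ i ∈ F, C i).Nonempty := fun F hF => by
    have := hF.to_subtype
    obtain ⟨q, hq, hqK⟩ := exists_dist_le_and_sub_mem_convexHull (fun i j : F => hab i j) p
    have hq_mem : p - q ∈ K := convexHull_min (range_subset_iff.2 fun i : F => habK i) hK hqK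
    exact ⟨q, mem_iInter₂.2 fun i hi => ⟨hq ⟨i, hi⟩, hq_mem⟩⟩
  obtain ⟨q, hq⟩ := nonempty_iInter_of_convex_of_isClosed
    surjective_inclusionInDoubleDual C_convex C_closed
    (isBounded_closedBall.subset (inter_subset_left : C i₀ ⊆ _)) C_finite_inter
  rw [mem_iInter] at hq
  exact ⟨q, fun i => (hq i).1, (hq i₀).2⟩

end OnePoint

/-- The graph `G` of a nonexpansive relation whose displacements `x - y`, `(x, y) ∈ G`, lie in `K`.
Zorn's lemma is applied to graphs, so that no partially defined functions are needed. -/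
structure IsNonexpansiveGraph {E : Type*} [SeminormedAddCommGroup E] (K : Set E)
    (G : Set (E × E)) : Prop where
  dist_le : ∀ g ∈ G, ∀ h ∈ G, dist g.2 h.2 ≤ dist g.1 h.1
  sub_mem : ∀ g ∈ G, g.1 - g.2 ∈ K

namespace IsNonexpansiveGraph

section Seminormed

variable {E : Type*} [SeminormedAddCommGroup E] {K : Set E}

theorem sUnion_of_isChain {c : Set (Set (E × E))} (hc : IsChain (· ⊆ ·) c)
    (h : ∀ G ∈ c, IsNonexpansiveGraph K G) :
    IsNonexpansiveGraph K (⋃₀ c) where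
  dist_le := by
    rintro g ⟨G, hG, hg⟩ g' ⟨G', hG', hg'⟩
    rcases hc.total hG hG' with hle | hle
    · exact (h G' hG').dist_le g (hle hg) g' hg'
    · exact (h G hG).dist_le g hg g' (hle hg')
  sub_mem := by
    rintro g ⟨G, hG, hg⟩
    exact (h G hG).sub_mem g hg

protected theorem insert {G : Set (E × E)} (hG : IsNonexpansiveGraph K G) {p q : E}
    (hq : ∀ g ∈ G, dist q g.2 ≤ dist p g.1) (hpq : p - q ∈ K) :
    IsNonexpansiveGraph K (insert (p, q) G) where
  dist_le := by
    rintro g (rfl | hg) h (rfl | hh)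
    · simp
    · exact hq h hh
    · simpa only [dist_comm] using hq g hg
    · exact hG.dist_le g hg h hh
  sub_mem := by
    rintro g (rfl | hg)
    exacts [hpq, hG.sub_mem g hg]

end Seminormed

theorem exists_mem_of_maximal {E : Type*} [NormedAddCommGroup E] [InnerProductSpace ℝ E]
    [CompleteSpace E] {K : Set E} (hK : Convex ℝ K) (hK_closed : IsClosed K) (hK_ne : K.Nonempty)
    {G : Set (E × E)} (hG : Maximal (IsNonexpansiveGraph K) G) (p : E) : ∃ q, (p, q) ∈ G := by
  obtain ⟨q, hq, hpq⟩ := exists_dist_le_and_sub_mem hK hK_closed hK_ne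
    (fun g h : G => hG.prop.dist_le g g.2 h h.2) (fun g : G => hG.prop.sub_mem g g.2) p
  have hinsert := hG.prop.insert (fun g hg => hq ⟨g, hg⟩) hpq
  exact ⟨q, hG.le_of_ge hinsert (subset_insert _ _) (mem_insert _ _)⟩

end IsNonexpansiveGraph

theorem exists_lipschitzWith_one_extension_sub_mem {E : Type*} [NormedAddCommGroup E]
    [InnerProductSpace ℝ E] [CompleteSpace E] {K S : Set E} (hK : Convex ℝ K)
    (hK_closed : IsClosed K) (hK_ne : K.Nonempty) {f : E → E} (hf : LipschitzOnWith 1 f S)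
    (hfK : ∀ x ∈ S, x - f x ∈ K) :
    ∃ g : E → E, LipschitzWith 1 g ∧ EqOn g f S ∧ ∀ x, x - g x ∈ K := by
  have hgraph : IsNonexpansiveGraph K (S.graphOn f) :=
    ⟨by rintro _ ⟨x, hx, rfl⟩ _ ⟨y, hy, rfl⟩; simpa using hf.dist_le_mul x hx y hy,
      by rintro _ ⟨x, hx, rfl⟩; exact hfK x hx⟩
  obtain ⟨G, hfG, hG⟩ := zorn_subset_nonempty {G | IsNonexpansiveGraph K G}
    (fun c hcS hc _ => ⟨⋃₀ c, .sUnion_of_isChain hc hcS, fun _ => subset_sUnion_of_mem⟩) _ hgraph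
  choose g hg using IsNonexpansiveGraph.exists_mem_of_maximal hK hK_closed hK_ne hG
  refine ⟨g, .of_dist_le_mul fun x y => ?_, fun x hx => dist_le_zero.1 ?_,
    fun x => hG.prop.sub_mem _ (hg x)⟩
  · simpa using hG.prop.dist_le _ (hg x) _ (hg y)
  · simpa using hG.prop.dist_le _ (hg x) _ (hfG (mem_image_of_mem _ hx))

theorem exists_extension_norm_sub_le_sub_mem {Y E : Type*} [NormedAddCommGroup E]
    [InnerProductSpace ℝ E] [CompleteSpace E] {K : Set E} (hK : Convex ℝ K)
    (hK_closed : IsClosed K) (hK_ne : K.Nonempty) {v : Y → E} {A : Set Y} {u : A → E}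
    (huv : ∀ x y : A, ‖u x - u y‖ ≤ ‖v x - v y‖) (huK : ∀ x : A, v x - u x ∈ K) :
    ∃ u' : Y → E, (∀ x : A, u' x = u x) ∧ (∀ x y : Y, ‖u' x - u' y‖ ≤ ‖v x - v y‖) ∧
      ∀ x, v x - u' x ∈ K := by
  have u_factors : Function.FactorsThrough u fun x : A => v x := fun x y hxy =>
    sub_eq_zero.1 (norm_le_zero_iff.1 (by simpa [hxy] using huv x y))
  let f : E → E := Function.extend (fun x : A => v x) u id
  have f_apply : ∀ x : A, f (v x) = u x := u_factors.extend_apply id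
  have f_lipschitz : LipschitzOnWith 1 f (range fun x : A => v x) := by
    refine .of_dist_le_mul ?_
    rintro _ ⟨x, rfl⟩ _ ⟨y, rfl⟩
    simpa [f_apply, dist_eq_norm] using huv x y
  have f_displacement : ∀ z ∈ range fun x : A => v x, z - f z ∈ K := by
    rintro _ ⟨x, rfl⟩
    simpa only [f_apply] using huK x
  obtain ⟨g, g_lipschitz, g_eq, g_displacement⟩ :=
    exists_lipschitzWith_one_extension_sub_mem hK hK_closed hK_ne f_lipschitz f_displacement
  refine ⟨g ∘ v, fun x => (g_eq (mem_range_self x)).trans (f_apply x), fun x y => ?_,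
    fun x => g_displacement (v x)⟩
  simpa [dist_eq_norm] using g_lipschitz.dist_le_mul (v x) (v y)

theorem mainTheorem5_general {Y E : Type*} [NormedAddCommGroup E] [InnerProductSpace ℝ E]
    [CompleteSpace E] (v : Y → E) (A : Set Y) (u : A → E)
    (huv : ∀ x y : A, ‖u x - u y‖ ≤ ‖v x - v y‖) :
    ∃ u' : Y → E,
      (∀ x : A, u' x = u x) ∧
      (∀ x y : Y, ‖u' x - u' y‖ ≤ ‖v x - v y‖) ∧
      (∀ δ : ℝ, 0 ≤ δ → (∀ x : A, ‖v x - u x‖ ≤ δ) → ∀ x : Y, ‖v x - u' x‖ ≤ δ) := by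
  let K : Set E := ⋂ δ ∈ {δ : ℝ | 0 ≤ δ ∧ ∀ x : A, ‖v x - u x‖ ≤ δ}, closedBall 0 δ
  have K_convex : Convex ℝ K := convex_iInter₂ fun _ _ => convex_closedBall _ _
  have K_closed : IsClosed K := isClosed_biInter fun _ _ => isClosed_closedBall
  have zero_mem : (0 : E) ∈ K := mem_iInter₂.2 fun _ hδ => mem_closedBall_self hδ.1
  have displacement_mem : ∀ x : A, v x - u x ∈ K := fun x =>
    mem_iInter₂.2 fun _ hδ => mem_closedBall_zero_iff.2 (hδ.2 x)
  obtain ⟨u', u'_eq, u'_le, u'_mem⟩ :=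
    exists_extension_norm_sub_le_sub_mem K_convex K_closed ⟨0, zero_mem⟩ huv displacement_mem
  exact ⟨u', u'_eq, u'_le, fun δ hδ hδu x =>
    mem_closedBall_zero_iff.1 (mem_iInter₂.1 (u'_mem x) δ ⟨hδ, hδu⟩)⟩

theorem mainTheorem5 {Y : Type*} (m : ℕ) (v : Y → EuclideanSpace ℝ (Fin m))
    (A : Set Y) (u : A → EuclideanSpace ℝ (Fin m))
    (huv : ∀ x y : A, ‖u x - u y‖ ≤ ‖v x - v y‖) :
    ∃ u' : Y → EuclideanSpace ℝ (Fin m),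
      (∀ x : A, u' x = u x) ∧
      (∀ x y : Y, ‖u' x - u' y‖ ≤ ‖v x - v y‖) ∧
      (∀ δ : ℝ, 0 ≤ δ → (∀ x : A, ‖v x - u x‖ ≤ δ) → ∀ x : Y, ‖v x - u' x‖ ≤ δ) :=
  mainTheorem5_general v A u huv
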